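/- A finitely supported probability vector is a finitely supported sequence $x=(x_i)_{i\in\mathbb N}$ of nonnegative reals with $\sum_i x_i=1$; a probability vector in $\mathbb R^d$ is identified with such a sequence by appending zeros. Let $P_{<\infty}$ be the set of all of them. For finitely supported families $a,b$ of nonnegative reals, write $a\prec b$ ($a$ is majorized by $b$) if $\sum_i a_i=\sum_i b_i$ and, for every $k\ge 1$, $\sum_{i=1}^k a_i^{\downarrow}\le\sum_{i=1}^k b_i^{\downarrow}$, where $a^{\downarrow}$ is the decreasing rearrangement of $a$. Let $a\otimes b=(a_ib_j)_{i,j}$, and let $a^{\otimes n}$ be the $n$-fold tensor power. For $y\in P_{<\infty}$ put \[M_{<\infty}(y)=\{x\in P_{<\infty}:\ \exists\, n\ge 1,\ x^{\otimes n}\prec y^{\otimes n}\},\qquad T_{<\infty}(y)=\{x\in P_{<\infty}:\ \exists\, z\in P_{<\infty},\ x\otimes z\prec y\otimes z\},\] and let $\overline{M_{<\infty}(y)}$ and $\overline{T_{<\infty}(y)}$ be their closures in $\ell_1$ with respect to the $\ell_1$-norm. For real $p\ge 1$ let $\|x\|_p=\big(\sum_i x_i^p\big)^{1/p}$. Theorem.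 Let $x,y\in P_{<\infty}$. The following assertions are equivalent: (a) $x\in\overline{M_{<\infty}(y)}$; (b) $x\in\overline{T_{<\infty}(y)}$; (c) $\|x\|_p\le\|y\|_p$ for all real $p\ge 1$. -/

import Mathlib

namespace CatMaj

noncomputable section

/-- The finitely supported probability vectors: finitely supported real sequences with
nonnegative terms and total mass `1`. A vector of length `d` is identified with the sequence
obtained by appending zeros. -/
def probVec : Set (ℕ →₀ ℝ) :=
  {x | (∀ i, 0 ≤ x i) ∧ x.sum (fun _ t => t) = 1}

/-- The decreasing rearrangement of a finitely supported *nonnegative* family: its nonzero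
coordinates (with multiplicity) in decreasing order, followed by zeros. -/
def decr {ι : Type*} (x : ι →₀ ℝ) (i : ℕ) : ℝ :=
  ((x.support.val.map x).sort (· ≥ ·)).getD i 0

/-- Majorization of finitely supported nonnegative families: the totals agree and, for every `k`,
the sum of the `k` largest coordinates of `x` is at most that of `y`. -/
def Majorizes {ι : Type*} (y x : ι →₀ ℝ) : Prop :=
  x.sum (fun _ t => t) = y.sum (fun _ t => t) ∧
    ∀ k : ℕ, ∑ i ∈ Finset.range k, decr x i ≤ ∑ i ∈ Finset.range k, decr y i

/-- The tensor product `(x i * z j)` indexed by pairs `(i, j)`. -/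
def tensor {ι κ : Type*} (x : ι →₀ ℝ) (z : κ →₀ ℝ) : ι × κ →₀ ℝ :=
  Finsupp.onFinset (x.support ×ˢ z.support) (fun q => x q.1 * z q.2) (by
    intro q hq
    rw [Finset.mem_product, Finsupp.mem_support_iff, Finsupp.mem_support_iff]
    exact ⟨left_ne_zero_of_mul hq, right_ne_zero_of_mul hq⟩)

/-- The `n`-fold tensor power `(x (i 0) * ⋯ * x (i (n - 1)))` indexed by `n`-tuples `i`. -/
def tensorPow {ι : Type*} (x : ι →₀ ℝ) (n : ℕ) : (Fin n → ι) →₀ ℝ :=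
  Finsupp.onFinset (Fintype.piFinset fun _ : Fin n => x.support) (fun i => ∏ k, x (i k)) (by
    intro i hi
    rw [Fintype.mem_piFinset]
    intro k
    rw [Finsupp.mem_support_iff]
    exact Finset.prod_ne_zero_iff.mp hi k (Finset.mem_univ k))

/-- The finitely supported probability vectors `x` with `x^{⊗n} ≺ y^{⊗n}` for some `n ≥ 1`. -/
def multiCopySet (y : ℕ →₀ ℝ) : Set (ℕ →₀ ℝ) :=
  {x | x ∈ probVec ∧ ∃ n : ℕ, 1 ≤ n ∧ Majorizes (tensorPow y n) (tensorPow x n)}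

/-- The finitely supported probability vectors `x` trumped by `y`: `x ⊗ z ≺ y ⊗ z` for some
finitely supported probability vector `z` (the catalyst). -/
def trumpedSet (y : ℕ →₀ ℝ) : Set (ℕ →₀ ℝ) :=
  {x | x ∈ probVec ∧ ∃ z ∈ probVec, Majorizes (tensor y z) (tensor x z)}

theorem memℓp_finsupp (x : ℕ →₀ ℝ) : Memℓp (fun i => x i) 1 := by
  have h : Memℓp (fun i => x i) 0 := memℓp_zero x.hasFiniteSupport
  exact h.of_exponent_ge zero_le_one

/-- A finitely supported sequence as an element of the Banach space `ℓ¹`. -/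
def toL1 (x : ℕ →₀ ℝ) : lp (fun _ : ℕ => ℝ) 1 :=
  ⟨fun i => x i, memℓp_finsupp x⟩

/-- The `ℓ_p` norm `(∑ x_i ^ p) ^ (1 / p)` of a nonnegative finitely supported sequence. -/
def pNorm (p : ℝ) (x : ℕ →₀ ℝ) : ℝ :=
  (∑ i ∈ x.support, x i ^ p) ^ (1 / p)

end

end CatMaj

namespace CatMaj

open Finset

/-! Everything is read off excess sums `∑ max (v - t) 0`: majorization means equal totals and
ordered excesses at every `t ≥ 0` (`majorizes_iff`).

Many copies give a catalyst: writing direct sum and tensor product as `+` and `*`, the family `Z = ∑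
x^k y^(n-1-k)` satisfies `(x - y) Z = x^n - y^n`, so `Z / n` works
(`multiCopySet_subset_trumpedSet`). Power sums with `p ≥ 1` are monotone under majorization and
multiplicative under tensoring, so the catalyst cancels, and the resulting inequality is closed in
`ℓ¹` (`fsum_rpow_le_of_mem_closure`).

The substance is the return from norms to many copies. Moving mass `ε` of `x` onto many tiny atoms
makes all power sum inequalities with `p > 1` strict, and also the one between the maxima, at `ℓ¹`
cost `2ε` (`exists_spread_mem_multiCopySet`). Strictness then suffices by large deviations
(`exists_majorizes_tensorPow`). The excess of `x^{⊗n}` over `u` has a Chernoff upper bound with any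
exponent; that of `y^{⊗n}` has a matching Cramér lower bound when the exponent `l` is tuned so that
the tilted mean of `log y` is near `log u / n`. A compact range of `l` is enough, so the strict gap
is uniform and wins for one large `n`. Near `l = 0` the gap closes, and the tiny atoms supply a
separate estimate with a fixed exponent `s₀`. -/

/-! ### Majorization, excess sums and power sums -/

/-- The sum of `F` over the nonzero coordinates of a finitely supported family. -/
noncomputable def fsum {ι : Type*} (F : ℝ → ℝ) (x : ι →₀ ℝ) : ℝ :=
  ∑ i ∈ x.support, F (x i)

theorem sum_eq_fsum {ι : Type*} (x : ι →₀ ℝ) : x.sum (fun _ t => t) = fsum (fun t => t) x := rfl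

theorem fsum_le_fsum {ι : Type*} {F G : ℝ → ℝ} {x : ι →₀ ℝ} (hx : ∀ i, 0 ≤ x i)
    (h : ∀ v, 0 < v → F v ≤ G v) : fsum F x ≤ fsum G x := by
  refine Finset.sum_le_sum fun i hi => h _ ?_
  exact lt_of_le_of_ne (hx i) (Ne.symm (Finsupp.mem_support_iff.mp hi))

theorem fsum_congr {ι : Type*} {F G : ℝ → ℝ} {x : ι →₀ ℝ} (hx : ∀ i, 0 ≤ x i)
    (h : ∀ v, 0 < v → F v = G v) : fsum F x = fsum G x :=
  le_antisymm (fsum_le_fsum hx fun v hv => (h v hv).le) (fsum_le_fsum hx fun v hv => (h v hv).ge)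

theorem fsum_add {ι : Type*} (F G : ℝ → ℝ) (x : ι →₀ ℝ) :
    fsum (fun v => F v + G v) x = fsum F x + fsum G x := Finset.sum_add_distrib

theorem fsum_sub {ι : Type*} (F G : ℝ → ℝ) (x : ι →₀ ℝ) :
    fsum (fun v => F v - G v) x = fsum F x - fsum G x := Finset.sum_sub_distrib _ _

theorem fsum_const_mul {ι : Type*} (c : ℝ) (F : ℝ → ℝ) (x : ι →₀ ℝ) :
    fsum (fun v => c * F v) x = c * fsum F x := (Finset.mul_sum _ _ _).symm

theorem sum_range_getD (F : ℝ → ℝ) (hF : F 0 = 0) (l : List ℝ) (N : ℕ) (hN : l.length ≤ N) :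
    ∑ i ∈ range N, F (l.getD i 0) = (l.map F).sum := by
  induction l generalizing N with
  | nil => simp [hF]
  | cons a l ih =>
    cases N with
    | zero => simp at hN
    | succ N =>
      rw [Finset.sum_range_succ']
      have := ih N (by simpa using hN)
      simp only [List.getD_cons_succ, List.getD_cons_zero, List.map_cons, List.sum_cons, this]
      ring

theorem sum_range_decr {ι : Type*} (F : ℝ → ℝ) (hF : F 0 = 0) (x : ι →₀ ℝ) (N : ℕ)
    (hN : x.support.card ≤ N) : ∑ i ∈ range N, F (decr x i) = fsum F x := by
  unfold decr
  rw [sum_range_getD F hF _ N (by simpa using hN), ← Multiset.sum_coe, ← Multiset.map_coe,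
    Multiset.sort_eq, Multiset.map_map]
  rfl

theorem decr_nonneg {ι : Type*} {x : ι →₀ ℝ} (hx : ∀ i, 0 ≤ x i) (k : ℕ) : 0 ≤ decr x k := by
  unfold decr
  rw [List.getD_eq_getElem?_getD]
  cases h : ((x.support.val.map x).sort (· ≥ ·))[k]? with
  | none => simp
  | some a =>
    have := List.mem_of_getElem? h
    rw [Multiset.mem_sort, Multiset.mem_map] at this
    obtain ⟨i, -, rfl⟩ := this
    simpa using hx i

theorem decr_antitone {ι : Type*} {x : ι →₀ ℝ} (hx : ∀ i, 0 ≤ x i) : Antitone (decr x) := by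
  intro i j hij
  by_cases hj : j < ((x.support.val.map x).sort (· ≥ ·)).length
  · have hp : ((x.support.val.map x).sort (· ≥ ·)).SortedGE :=
      List.sortedGE_iff_pairwise.2 (Multiset.pairwise_sort _ _)
    unfold decr
    rw [List.getD_eq_getElem _ _ hj, List.getD_eq_getElem _ _ (lt_of_le_of_lt hij hj)]
    exact hp.getElem_ge_getElem_of_le hij
  · have : decr x j = 0 := List.getD_eq_default _ _ (not_lt.1 hj)
    rw [this]
    exact decr_nonneg hx i

/-- With `sum_decr_eq` this is a variational formula: the sum of the `k` largest values is the
minimum over `t ≥ 0` of `k * t` plus the excess over `t`, attained at the value ranked just after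
the first `k`. -/
theorem sum_decr_le {ι : Type*} {x : ι →₀ ℝ} {t : ℝ} (ht : 0 ≤ t) (k : ℕ) :
    ∑ i ∈ range k, decr x i ≤ k * t + fsum (fun v => max (v - t) 0) x := by
  have h0 : max (0 - t) 0 = 0 := max_eq_right (by linarith)
  rw [← sum_range_decr (fun v => max (v - t) 0) h0 x (max k x.support.card) (le_max_right _ _)]
  calc ∑ i ∈ range k, decr x i ≤ ∑ i ∈ range k, (t + max (decr x i - t) 0) :=
        Finset.sum_le_sum fun i _ => by linarith [le_max_left (decr x i - t) 0]
    _ = k * t + ∑ i ∈ range k, max (decr x i - t) 0 := by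
        rw [Finset.sum_add_distrib]; simp
    _ ≤ _ := by
        gcongr
        exact le_max_left _ _

theorem sum_decr_eq {ι : Type*} {x : ι →₀ ℝ} (hx : ∀ i, 0 ≤ x i) (k : ℕ) :
    ∑ i ∈ range k, decr x i = k * decr x k + fsum (fun v => max (v - decr x k) 0) x := by
  have ht := decr_nonneg hx k
  have h0 : max (0 - decr x k) 0 = 0 := max_eq_right (by linarith)
  rw [← sum_range_decr (fun v => max (v - decr x k) 0) h0 x (max k x.support.card)
    (le_max_right _ _)]
  have h1 : ∑ i ∈ range (max k x.support.card), max (decr x i - decr x k) 0 =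
      ∑ i ∈ range k, max (decr x i - decr x k) 0 := by
    symm
    refine Finset.sum_subset (by simp) fun i _ hi => max_eq_right ?_
    have := decr_antitone hx (not_lt.1 (by simpa using hi) : k ≤ i)
    linarith
  have h2 : ∑ i ∈ range k, max (decr x i - decr x k) 0 = ∑ i ∈ range k, (decr x i - decr x k) :=
    Finset.sum_congr rfl fun i hi => max_eq_left (by
      linarith [decr_antitone hx (Finset.mem_range.1 hi).le])
  rw [h1, h2, Finset.sum_sub_distrib]
  simp

theorem majorizes_iff {ι : Type*} {x y : ι →₀ ℝ} (hx : ∀ i, 0 ≤ x i) (hy : ∀ i, 0 ≤ y i) :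
    Majorizes y x ↔ fsum (fun t => t) x = fsum (fun t => t) y ∧
      ∀ t : ℝ, 0 ≤ t → fsum (fun v => max (v - t) 0) x ≤ fsum (fun v => max (v - t) 0) y := by
  refine and_congr Iff.rfl ⟨fun h t ht => ?_, fun h k => ?_⟩
  · have h0 : max (0 - t) 0 = 0 := max_eq_right (by linarith)
    have hex : ∃ k, decr x k ≤ t := ⟨x.support.card, by
      have : decr x x.support.card = 0 := List.getD_eq_default _ _ (by simp)
      rw [this]; exact ht⟩
    classical
    -- `k` counts the values exceeding `t`; for this `k` the excess of `x` is exactly its top `k`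
    -- sum minus `k * t`.
    set k := Nat.find hex
    have hk : decr x k ≤ t := Nat.find_spec hex
    have hlt : ∀ i, i < k → t ≤ decr x i := fun i hi => (not_le.1 (Nat.find_min hex hi)).le
    have h1 : fsum (fun v => max (v - t) 0) x = ∑ i ∈ range k, decr x i - k * t := by
      rw [← sum_range_decr (fun v => max (v - t) 0) h0 x (max k x.support.card) (le_max_right _ _)]
      have h1 : ∑ i ∈ range (max k x.support.card), max (decr x i - t) 0 =
          ∑ i ∈ range k, max (decr x i - t) 0 := by
        symm
        refine Finset.sum_subset (by simp) fun i _ hi => max_eq_right ?_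
        have := decr_antitone hx (not_lt.1 (by simpa using hi) : k ≤ i)
        linarith
      have h2 : ∑ i ∈ range k, max (decr x i - t) 0 = ∑ i ∈ range k, (decr x i - t) :=
        Finset.sum_congr rfl fun i hi => max_eq_left (by linarith [hlt i (Finset.mem_range.1 hi)])
      rw [h1, h2, Finset.sum_sub_distrib]
      simp
    linarith [h k, sum_decr_le (x := y) ht k]
  · rw [sum_decr_eq hy k]
    have := h _ (decr_nonneg hy k)
    linarith [sum_decr_le (x := x) (decr_nonneg hy k) k]

/-- Summation by parts, as an induction on `k`. -/
theorem sum_mul_nonneg_of_antitone {c d : ℕ → ℝ} (hc : Antitone c)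
    (hd : ∀ k, 0 ≤ ∑ i ∈ range k, d i) (k : ℕ) :
    c k * ∑ i ∈ range k, d i ≤ ∑ i ∈ range k, c i * d i := by
  induction k with
  | zero => simp
  | succ k ih =>
    rw [Finset.sum_range_succ (fun i => c i * d i)]
    calc c (k + 1) * ∑ i ∈ range (k + 1), d i ≤ c k * ∑ i ∈ range (k + 1), d i :=
          mul_le_mul_of_nonneg_right (hc (Nat.le_succ k)) (hd _)
      _ ≤ _ := by rw [Finset.sum_range_succ, mul_add]; linarith

theorem rpow_sub_rpow_ge {a b p : ℝ} (ha : 0 ≤ a) (hb : 0 ≤ b) (hp : 1 ≤ p) :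
    p * a ^ (p - 1) * (b - a) ≤ b ^ p - a ^ p := by
  rcases hp.eq_or_lt with rfl | hp1
  · simp
  rcases ha.eq_or_lt with rfl | ha'
  · rw [Real.zero_rpow (by linarith), Real.zero_rpow (by linarith)]
    simpa using Real.rpow_nonneg hb p
  have h1 := one_add_mul_self_le_rpow_one_add (s := b / a - 1)
    (by have : 0 ≤ b / a := div_nonneg hb ha
        linarith) hp
  rw [show 1 + (b / a - 1) = b / a by ring, Real.div_rpow hb ha, le_div_iff₀ (by positivity)] at h1
  have h2 : a ^ p = a ^ (p - 1) * a := by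
    rw [← Real.rpow_add_one ha'.ne']; ring_nf
  have h3 : (1 + p * (b / a - 1)) * a ^ p = a ^ p + p * a ^ (p - 1) * (b - a) := by
    rw [h2]; field_simp
  linarith

/-- Tangent lines of `v ^ p` at the sorted values of `x` bound the difference of power sums below;
their slopes decrease along the sorting, so summation by parts against the majorization inequalities
gives the sign. -/
theorem Majorizes.fsum_rpow_le {ι : Type*} {x y : ι →₀ ℝ} (hx : ∀ i, 0 ≤ x i) (hy : ∀ i, 0 ≤ y i)
    (h : Majorizes y x) {p : ℝ} (hp : 1 ≤ p) :
    fsum (fun v => v ^ p) x ≤ fsum (fun v => v ^ p) y := by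
  have h0 : (0 : ℝ) ^ p = 0 := Real.zero_rpow (by linarith)
  set N := max x.support.card y.support.card
  rw [← sum_range_decr _ h0 x N (le_max_left _ _), ← sum_range_decr _ h0 y N (le_max_right _ _),
    ← sub_nonneg, ← Finset.sum_sub_distrib]
  have hd : ∀ k, 0 ≤ ∑ i ∈ range k, (decr y i - decr x i) := fun k => by
    rw [Finset.sum_sub_distrib]; linarith [h.2 k]
  have hc0 : ∀ i, 0 ≤ p * decr x i ^ (p - 1) := fun i =>
    mul_nonneg (by linarith) (Real.rpow_nonneg (decr_nonneg hx i) _)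
  have hc : Antitone fun i => p * decr x i ^ (p - 1) := fun i j hij =>
    mul_le_mul_of_nonneg_left (Real.rpow_le_rpow (decr_nonneg hx j) (decr_antitone hx hij)
      (by linarith)) (by linarith)
  have := sum_mul_nonneg_of_antitone hc hd N
  refine le_trans (mul_nonneg (hc0 N) (hd N)) (this.trans (Finset.sum_le_sum fun i _ => ?_))
  exact rpow_sub_rpow_ge (decr_nonneg hx i) (decr_nonneg hy i) hp

/-! ### The formal sum of the values of a family -/

/-- The formal sum of the nonzero values of a family, as an element of the monoid algebra of the
multiplicative monoid `ℝ`. -/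
noncomputable def hist {ι : Type*} (x : ι →₀ ℝ) : MonoidAlgebra ℤ ℝ :=
  ∑ i ∈ x.support, MonoidAlgebra.of ℤ ℝ (x i)

/-- The additive functional sending the formal value `a` to `F a`. -/
noncomputable def histEval (F : ℝ → ℝ) (P : MonoidAlgebra ℤ ℝ) : ℝ :=
  P.coeff.sum fun a k => k * F a

theorem histEval_add (F : ℝ → ℝ) (P Q : MonoidAlgebra ℤ ℝ) :
    histEval F (P + Q) = histEval F P + histEval F Q := by
  unfold histEval
  rw [MonoidAlgebra.coeff_add, Finsupp.sum_add_index']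
  · simp
  · intros; push_cast; ring

theorem histEval_zero (F : ℝ → ℝ) : histEval F 0 = 0 := by simp [histEval]

theorem histEval_sum (F : ℝ → ℝ) {ι : Type*} (s : Finset ι) (P : ι → MonoidAlgebra ℤ ℝ) :
    histEval F (∑ i ∈ s, P i) = ∑ i ∈ s, histEval F (P i) :=
  map_sum (AddMonoidHom.mk' (histEval F) (histEval_add F)) P s

theorem histEval_of (F : ℝ → ℝ) (a : ℝ) : histEval F (MonoidAlgebra.of ℤ ℝ a) = F a := by
  simp [histEval]

theorem histEval_hist {ι : Type*} (F : ℝ → ℝ) (x : ι →₀ ℝ) : histEval F (hist x) = fsum F x := by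
  rw [hist, histEval_sum]
  exact Finset.sum_congr rfl fun i _ => histEval_of F (x i)

theorem histEval_of_mul (F : ℝ → ℝ) (a : ℝ) (P : MonoidAlgebra ℤ ℝ) :
    histEval F (MonoidAlgebra.of ℤ ℝ a * P) = histEval (fun v => F (a * v)) P := by
  induction P using MonoidAlgebra.induction_linear with
  | zero => simp [histEval_zero]
  | add P Q hP hQ => rw [mul_add, histEval_add, histEval_add, hP, hQ]
  | single m r => simp [histEval, MonoidAlgebra.single_mul_single]

/-- Since `hist` forgets the index type and turns tensoring into a commutative product, identities
between tensor expressions become ring identities, and `histEval` transfers them to every sum `fsum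
F`. -/
theorem hist_tensor {ι κ : Type*} (x : ι →₀ ℝ) (z : κ →₀ ℝ) :
    hist (tensor x z) = hist x * hist z := by
  have hs : (tensor x z).support = x.support ×ˢ z.support := by
    ext q
    simp [tensor]
  unfold hist
  rw [hs, Finset.sum_mul_sum, Finset.sum_product]
  refine Finset.sum_congr rfl fun i _ => Finset.sum_congr rfl fun j _ => ?_
  rw [← map_mul]
  rfl

theorem hist_tensorPow {ι : Type*} (x : ι →₀ ℝ) (n : ℕ) :
    hist (tensorPow x n) = hist x ^ n := by
  classical
  have hs : (tensorPow x n).support = Fintype.piFinset fun _ : Fin n => x.support := by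
    ext q
    simp [tensorPow, Finset.prod_eq_zero_iff]
  unfold hist
  have := Finset.prod_univ_sum (fun _ : Fin n => x.support)
    (fun _ i => MonoidAlgebra.of ℤ ℝ (x i))
  rw [Finset.prod_const, Finset.card_univ, Fintype.card_fin] at this
  rw [this, hs]
  refine Finset.sum_congr rfl fun p _ => ?_
  rw [← map_prod]
  rfl

theorem tensorPow_nonneg {ι : Type*} {x : ι →₀ ℝ} (hx : ∀ i, 0 ≤ x i) (n : ℕ) (p : Fin n → ι) :
    0 ≤ tensorPow x n p := by
  change 0 ≤ ∏ k, x (p k)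
  exact Finset.prod_nonneg fun k _ => hx (p k)

theorem tensor_nonneg {ι κ : Type*} {x : ι →₀ ℝ} {z : κ →₀ ℝ} (hx : ∀ i, 0 ≤ x i)
    (hz : ∀ i, 0 ≤ z i) (p : ι × κ) : 0 ≤ tensor x z p := mul_nonneg (hx p.1) (hz p.2)

theorem fsum_tensor {ι κ : Type*} (F : ℝ → ℝ) (x : ι →₀ ℝ) (z : κ →₀ ℝ) :
    fsum F (tensor x z) = fsum (fun a => fsum (fun v => F (a * v)) z) x := by
  rw [← histEval_hist, hist_tensor]
  simp only [hist.eq_1 x, Finset.sum_mul, histEval_sum, histEval_of_mul, histEval_hist]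
  rfl

theorem fsum_tensorPow_zero {ι : Type*} (F : ℝ → ℝ) (x : ι →₀ ℝ) :
    fsum F (tensorPow x 0) = F 1 := by
  rw [← histEval_hist, hist_tensorPow, pow_zero, ← map_one (MonoidAlgebra.of ℤ ℝ), histEval_of]

theorem fsum_tensorPow_succ {ι : Type*} (F : ℝ → ℝ) (x : ι →₀ ℝ) (n : ℕ) :
    fsum F (tensorPow x (n + 1)) = fsum (fun a => fsum (fun v => F (a * v)) (tensorPow x n)) x := by
  rw [← histEval_hist, hist_tensorPow, pow_succ', ← hist_tensorPow, ← hist_tensor, histEval_hist,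
    fsum_tensor]

theorem fsum_rpow_tensorPow {ι : Type*} {x : ι →₀ ℝ} (hx : ∀ i, 0 ≤ x i) (q : ℝ) (n : ℕ) :
    fsum (fun v => v ^ q) (tensorPow x n) = fsum (fun v => v ^ q) x ^ n := by
  induction n with
  | zero => simp [fsum_tensorPow_zero]
  | succ n ih =>
    rw [fsum_tensorPow_succ, pow_succ', ← ih, mul_comm, ← fsum_const_mul]
    refine fsum_congr hx fun a ha => ?_
    rw [mul_comm, ← fsum_const_mul]
    exact fsum_congr (tensorPow_nonneg hx n) fun v hv => Real.mul_rpow ha.le hv.le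

theorem fsum_rpow_tensor {ι κ : Type*} {x : ι →₀ ℝ} {z : κ →₀ ℝ} (hx : ∀ i, 0 ≤ x i)
    (hz : ∀ i, 0 ≤ z i) (q : ℝ) :
    fsum (fun v => v ^ q) (tensor x z) = fsum (fun v => v ^ q) x * fsum (fun v => v ^ q) z := by
  rw [fsum_tensor, mul_comm, ← fsum_const_mul]
  refine fsum_congr hx fun a ha => ?_
  rw [mul_comm, ← fsum_const_mul]
  exact fsum_congr hz fun v hv => Real.mul_rpow ha.le hv.le

theorem exists_hist_eq (s : Multiset ℝ) (hs : ∀ a ∈ s, 0 < a) :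
    ∃ z : ℕ →₀ ℝ, (∀ i, 0 ≤ z i) ∧ hist z = (s.map (MonoidAlgebra.of ℤ ℝ)).sum := by
  obtain ⟨l, rfl⟩ := Quot.exists_rep s
  have hl : ∀ a ∈ l, 0 < a := hs
  have hpos : ∀ i, i < l.length → 0 < l.getD i 0 := fun i hi => by
    rw [List.getD_eq_getElem _ _ hi]
    exact hl _ (List.getElem_mem hi)
  have hzero : ∀ i, ¬ i < l.length → l.getD i 0 = 0 := fun i hi =>
    List.getD_eq_default _ _ (not_lt.1 hi)
  let z : ℕ →₀ ℝ := Finsupp.onFinset (range l.length) (fun i => l.getD i 0) fun i hi => by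
    by_contra h
    exact hi (hzero i (by simpa using h))
  have hz : ∀ i, z i = l.getD i 0 := fun i => rfl
  have hsupp : z.support = range l.length := by
    ext i
    rw [Finsupp.mem_support_iff, hz, Finset.mem_range]
    exact ⟨fun h => by_contra fun h' => h (hzero i h'), fun h => (hpos i h).ne'⟩
  refine ⟨z, fun i => ?_, ?_⟩
  · by_cases hi : i < l.length
    · exact (hpos i hi).le
    · exact (hzero i hi).ge
  · change hist z = (((l : Multiset ℝ)).map (MonoidAlgebra.of ℤ ℝ)).sum
    rw [hist, hsupp, Multiset.map_coe, Multiset.sum_coe, ← Fin.sum_univ_getElem, Finset.sum_range]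
    simp only [hz]
    rw [← (finCongr (List.length_map (as := l) (MonoidAlgebra.of ℤ ℝ))).sum_comp]
    refine Finset.sum_congr rfl fun i _ => ?_
    have hi : (i : ℕ) < l.length := by simpa using i.2
    simp [hi]

/-- Realizes a rescaled direct sum of families over different index types as one sequence on `ℕ`,
the form required of a catalyst. -/
theorem exists_hist_eq_smul_sum {κ : Type*} (s : Finset κ) {c : ℝ} (hc : 0 < c)
    {ι : κ → Type*} (w : ∀ k, ι k →₀ ℝ) (hw : ∀ k i, 0 ≤ w k i) :
    ∃ z : ℕ →₀ ℝ, (∀ i, 0 ≤ z i) ∧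
      hist z = MonoidAlgebra.of ℤ ℝ c * ∑ k ∈ s, hist (w k) := by
  obtain ⟨z, hz, h⟩ := exists_hist_eq
    (∑ k ∈ s, (w k).support.val.map fun i => c * w k i) (by
      intro a ha
      rw [Multiset.mem_sum] at ha
      obtain ⟨k, -, ha⟩ := ha
      rw [Multiset.mem_map] at ha
      obtain ⟨i, hi, rfl⟩ := ha
      exact mul_pos hc (lt_of_le_of_ne (hw k i) (Ne.symm (Finsupp.mem_support_iff.mp hi))))
  refine ⟨z, hz, h.trans ?_⟩
  rw [← Multiset.coe_mapAddMonoidHom, map_sum, ← Multiset.coe_sumAddMonoidHom, map_sum,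
    Finset.mul_sum]
  refine Finset.sum_congr rfl fun k _ => ?_
  rw [hist, Finset.mul_sum]
  simp only [← map_mul]
  simp only [Multiset.coe_mapAddMonoidHom, Multiset.coe_sumAddMonoidHom, Multiset.map_map]
  rfl

/-! ### From many copies to a catalyst -/

theorem multiCopySet_subset_trumpedSet {y : ℕ →₀ ℝ} (hy : y ∈ probVec) :
    multiCopySet y ⊆ trumpedSet y := by
  rintro x ⟨hx, n, hn, h⟩
  refine ⟨hx, ?_⟩
  have hn0 : (0 : ℝ) < n := by exact_mod_cast hn
  have hw : ∀ k i, 0 ≤ tensor (tensorPow x k) (tensorPow y (n - 1 - k)) i := fun k i =>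
    tensor_nonneg (tensorPow_nonneg hx.1 k) (tensorPow_nonneg hy.1 _) i
  obtain ⟨z, hz, hzh⟩ := exists_hist_eq_smul_sum (range n) (inv_pos.2 hn0) _ hw
  -- The telescoping identity `(x - y) Z = x^n - y^n`, rearranged without subtraction.
  have hgeom : hist x * (∑ k ∈ range n, hist x ^ k * hist y ^ (n - 1 - k)) + hist y ^ n =
      hist y * (∑ k ∈ range n, hist x ^ k * hist y ^ (n - 1 - k)) + hist x ^ n := by
    have := (Commute.all (hist x) (hist y)).geom_sum₂_mul n
    linear_combination this
  simp only [hist_tensor, hist_tensorPow] at hzh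
  set Z := ∑ k ∈ range n, hist x ^ k * hist y ^ (n - 1 - k) with hZ
  have key : ∀ F : ℝ → ℝ, fsum F (tensor x z) + fsum (fun v => F ((n : ℝ)⁻¹ * v)) (tensorPow y n) =
      fsum F (tensor y z) + fsum (fun v => F ((n : ℝ)⁻¹ * v)) (tensorPow x n) := by
    intro F
    simp only [← histEval_hist, hist_tensor, hzh, hist_tensorPow]
    rw [mul_left_comm, mul_left_comm (hist y), histEval_of_mul, histEval_of_mul, ← histEval_add,
      ← histEval_add, hgeom]
  have sx : fsum (fun v => v ^ (1 : ℝ)) x = 1 := by simpa [fsum, Finsupp.sum] using hx.2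
  have sy : fsum (fun v => v ^ (1 : ℝ)) y = 1 := by simpa [fsum, Finsupp.sum] using hy.2
  have hzp : z ∈ probVec := by
    refine ⟨hz, ?_⟩
    rw [sum_eq_fsum, ← histEval_hist, hzh, histEval_of_mul, hZ, histEval_sum]
    have : ∀ k ∈ range n, histEval (fun v => (n : ℝ)⁻¹ * v) (hist x ^ k * hist y ^ (n - 1 - k)) =
        (n : ℝ)⁻¹ := fun k _ => by
      rw [← hist_tensorPow, ← hist_tensorPow, ← hist_tensor, histEval_hist, fsum_const_mul]
      have := fsum_rpow_tensor (tensorPow_nonneg hx.1 k) (tensorPow_nonneg hy.1 (n - 1 - k)) 1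
      rw [fsum_rpow_tensorPow hx.1, fsum_rpow_tensorPow hy.1, sx, sy] at this
      simp only [Real.rpow_one, one_pow, mul_one] at this
      rw [this, mul_one]
    rw [Finset.sum_congr rfl this]
    simp [hn0.ne']
  refine ⟨z, hzp, ?_⟩
  rw [majorizes_iff (tensor_nonneg hx.1 hz) (tensor_nonneg hy.1 hz)]
  rw [majorizes_iff (tensorPow_nonneg hx.1 n) (tensorPow_nonneg hy.1 n)] at h
  constructor
  · have := key fun v => v
    rw [fsum_const_mul, fsum_const_mul, h.1] at this
    linarith
  · intro t ht
    have := key fun v => max (v - t) 0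
    -- Normalizing the catalyst by `1 / n` turns the threshold `t` into `n * t` for the tensor
    -- powers.
    have hs : (fun v : ℝ => max ((n : ℝ)⁻¹ * v - t) 0) =
        fun v => (n : ℝ)⁻¹ * max (v - n * t) 0 := by
      funext v
      rw [mul_max_of_nonneg _ _ (inv_pos.2 hn0).le, mul_zero, mul_sub,
        inv_mul_cancel_left₀ hn0.ne']
    rw [hs, fsum_const_mul, fsum_const_mul] at this
    have h2 := mul_le_mul_of_nonneg_left (h.2 (n * t) (by positivity)) (inv_pos.2 hn0).le
    linarith

/-! ### Power sums under trumping and closure -/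

theorem fsum_rpow_le_of_mem_trumpedSet {x y : ℕ →₀ ℝ} (hy : y ∈ probVec) (hx : x ∈ trumpedSet y)
    {p : ℝ} (hp : 1 ≤ p) : fsum (fun v => v ^ p) x ≤ fsum (fun v => v ^ p) y := by
  obtain ⟨hx, z, hz, h⟩ := hx
  have h1 := h.fsum_rpow_le (tensor_nonneg hx.1 hz.1) (tensor_nonneg hy.1 hz.1) hp
  rw [fsum_rpow_tensor hx.1 hz.1, fsum_rpow_tensor hy.1 hz.1] at h1
  refine le_of_mul_le_mul_right h1 ?_
  refine Finset.sum_pos (fun i hi => Real.rpow_pos_of_pos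
    (lt_of_le_of_ne (hz.1 i) (Ne.symm (Finsupp.mem_support_iff.mp hi))) _) ?_
  by_contra hne
  have := hz.2
  rw [Finset.not_nonempty_iff_eq_empty] at hne
  simp [Finsupp.sum, hne] at this

theorem toL1_apply (x : ℕ →₀ ℝ) (i : ℕ) : (toL1 x : ∀ _ : ℕ, ℝ) i = x i := rfl

theorem fsum_rpow_le_of_mem_closure {x y : ℕ →₀ ℝ} (hx : x ∈ probVec) (hy : y ∈ probVec)
    (h : toL1 x ∈ closure (toL1 '' trumpedSet y)) {p : ℝ} (hp : 1 ≤ p) :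
    fsum (fun v => v ^ p) x ≤ fsum (fun v => v ^ p) y := by
  have hcont : ∀ i : ℕ, Continuous fun u : lp (fun _ : ℕ => ℝ) 1 => u i := fun i =>
    (continuous_apply i).comp (lp.uniformContinuous_coe (E := fun _ : ℕ => ℝ) (p := 1)).continuous
  -- Restricting the sum to the support of `x` leaves finitely many coordinates, so continuity is
  -- immediate; omitted terms of a trumped vector are nonnegative.
  have hclosed : IsClosed {u : lp (fun _ : ℕ => ℝ) 1 |
      ∑ i ∈ x.support, |u i| ^ p ≤ fsum (fun v => v ^ p) y} := by
    refine isClosed_le (continuous_finsetSum _ fun i _ => ?_) continuous_const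
    exact (hcont i).abs.rpow_const fun _ => Or.inr (by linarith)
  have hsub : toL1 '' trumpedSet y ⊆ {u : lp (fun _ : ℕ => ℝ) 1 |
      ∑ i ∈ x.support, |u i| ^ p ≤ fsum (fun v => v ^ p) y} := by
    rintro _ ⟨w, hw, rfl⟩
    refine le_trans ?_ (fsum_rpow_le_of_mem_trumpedSet hy hw hp)
    have h1 : ∑ i ∈ x.support, |w i| ^ p ≤ ∑ i ∈ x.support ∪ w.support, |w i| ^ p :=
      Finset.sum_le_sum_of_subset_of_nonneg Finset.subset_union_left
        fun i _ _ => Real.rpow_nonneg (abs_nonneg _) _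
    have h2 : ∑ i ∈ w.support, |w i| ^ p = ∑ i ∈ x.support ∪ w.support, |w i| ^ p := by
      refine Finset.sum_subset Finset.subset_union_right fun i _ hi => ?_
      rw [Finsupp.notMem_support_iff.1 hi, abs_zero, Real.zero_rpow (by linarith)]
    have h3 : ∑ i ∈ w.support, |w i| ^ p = fsum (fun v => v ^ p) w :=
      Finset.sum_congr rfl fun i _ => by rw [abs_of_nonneg (hw.1.1 i)]
    simp only [toL1_apply]
    linarith
  have := hclosed.closure_subset_iff.2 hsub h
  refine le_trans (le_of_eq ?_) this
  exact Finset.sum_congr rfl fun i _ => by rw [toL1_apply, abs_of_nonneg (hx.1 i)]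

theorem pNorm_le_pNorm_iff {x y : ℕ →₀ ℝ} (hx : ∀ i, 0 ≤ x i) (hy : ∀ i, 0 ≤ y i) {p : ℝ}
    (hp : 1 ≤ p) :
    pNorm p x ≤ pNorm p y ↔ fsum (fun v => v ^ p) x ≤ fsum (fun v => v ^ p) y :=
  Real.rpow_le_rpow_iff (Finset.sum_nonneg fun i _ => Real.rpow_nonneg (hx i) _)
    (Finset.sum_nonneg fun i _ => Real.rpow_nonneg (hy i) _) (by positivity)

/-! ### Chernoff and Cramér bounds for tensor powers -/

theorem fsum_tensorPow_eq_one {ι : Type*} {x : ι →₀ ℝ} (hx : ∀ i, 0 ≤ x i)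
    (sx : fsum (fun v => v) x = 1) (n : ℕ) : fsum (fun v => v) (tensorPow x n) = 1 := by
  have := fsum_rpow_tensorPow hx 1 n
  simpa [sx] using this

theorem support_nonempty {ι : Type*} {x : ι →₀ ℝ} (sx : fsum (fun v => v) x = 1) :
    x.support.Nonempty := by
  by_contra hne
  rw [Finset.not_nonempty_iff_eq_empty] at hne
  simp [fsum, hne] at sx

theorem fsum_pos {ι : Type*} {F : ℝ → ℝ} {x : ι →₀ ℝ} (hx : ∀ i, 0 ≤ x i)
    (sx : fsum (fun v => v) x = 1) (hF : ∀ v, 0 < v → 0 < F v) : 0 < fsum F x :=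
  Finset.sum_pos (fun i hi => hF _ (lt_of_le_of_ne (hx i)
    (Ne.symm (Finsupp.mem_support_iff.mp hi)))) (support_nonempty sx)

theorem le_fsum {ι : Type*} {F : ℝ → ℝ} {x : ι →₀ ℝ} (hF : ∀ i ∈ x.support, 0 ≤ F (x i))
    {i : ι} (hi : x i ≠ 0) : F (x i) ≤ fsum F x :=
  Finset.single_le_sum (f := fun i => F (x i)) hF (Finsupp.mem_support_iff.2 hi)

theorem fsum_le_fsum_of_mem {ι : Type*} {F G : ℝ → ℝ} {x : ι →₀ ℝ}
    (h : ∀ i ∈ x.support, F (x i) ≤ G (x i)) : fsum F x ≤ fsum G x :=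
  Finset.sum_le_sum h

/-- Chernoff bound for the excess of a tensor power over a threshold. -/
theorem fsum_excess_tensorPow_le {ι : Type*} {x : ι →₀ ℝ} (hx : ∀ i, 0 ≤ x i) {s u : ℝ}
    (hs : 0 ≤ s) (hu : 0 < u) (n : ℕ) :
    fsum (fun v => max (v - u) 0) (tensorPow x n) ≤
      fsum (fun v => v ^ (1 + s)) x ^ n * u ^ (-s) := by
  rw [← fsum_rpow_tensorPow hx, mul_comm, ← fsum_const_mul]
  refine fsum_le_fsum (tensorPow_nonneg hx n) fun v hv => ?_
  have h1 : 0 ≤ u ^ (-s) * v ^ (1 + s) := by positivity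
  refine max_le ?_ h1
  rcases le_total v u with h | h
  · linarith
  · have : 1 ≤ u ^ (-s) * v ^ s := by
      rw [Real.rpow_neg hu.le, ← div_eq_inv_mul, ← Real.div_rpow hv.le hu.le]
      exact Real.one_le_rpow ((one_le_div hu).2 h) hs
    rw [Real.rpow_add hv, Real.rpow_one]
    nlinarith

theorem fsum_centered_tensorPow {ι : Type*} {y : ι →₀ ℝ} (hy : ∀ i, 0 ≤ y i) {q m : ℝ}
    (hm : fsum (fun v => v ^ q * (Real.log v - m)) y = 0) (n : ℕ) :
    fsum (fun v => v ^ q * (Real.log v - n * m)) (tensorPow y n) = 0 := by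
  induction n with
  | zero => simp [fsum_tensorPow_zero]
  | succ n ih =>
    rw [fsum_tensorPow_succ]
    have h : ∀ a, 0 < a → fsum (fun v => (a * v) ^ q * (Real.log (a * v) - (n + 1 : ℕ) * m))
        (tensorPow y n) =
        fsum (fun v => v ^ q) y ^ n * (a ^ q * (Real.log a - m)) := fun a ha => by
      have h1 : fsum (fun v => (a * v) ^ q * (Real.log (a * v) - (n + 1 : ℕ) * m))
          (tensorPow y n) = fsum (fun v => a ^ q * (v ^ q * (Real.log v - n * m)) +
            (a ^ q * (Real.log a - m)) * v ^ q) (tensorPow y n) :=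
        fsum_congr (tensorPow_nonneg hy n) fun v hv => by
          rw [Real.mul_rpow ha.le hv.le, Real.log_mul ha.ne' hv.ne']
          push_cast; ring
      rw [h1, fsum_add, fsum_const_mul, fsum_const_mul, ih, fsum_rpow_tensorPow hy]
      ring
    rw [fsum_congr hy h, fsum_const_mul, hm, mul_zero]

/-- Under the weights `v ^ q`, `log` on a tensor power is a sum of independent copies: the cross
term is centered and vanishes, so variances add. -/
theorem fsum_variance_tensorPow_le {ι : Type*} {y : ι →₀ ℝ} (hy : ∀ i, 0 ≤ y i) {q m V : ℝ}
    (hm : fsum (fun v => v ^ q * (Real.log v - m)) y = 0)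
    (hV : fsum (fun v => v ^ q * (Real.log v - m) ^ 2) y ≤ V * fsum (fun v => v ^ q) y) (n : ℕ) :
    fsum (fun v => v ^ q * (Real.log v - n * m) ^ 2) (tensorPow y n) ≤
      n * V * fsum (fun v => v ^ q) y ^ n := by
  have hM : 0 ≤ fsum (fun v => v ^ q) y := Finset.sum_nonneg fun i _ => Real.rpow_nonneg (hy i) _
  induction n with
  | zero => simp [fsum_tensorPow_zero]
  | succ n ih =>
    rw [fsum_tensorPow_succ]
    set Q := fsum (fun v => v ^ q * (Real.log v - n * m) ^ 2) (tensorPow y n) with hQ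
    set M := fsum (fun v => v ^ q) y with hMdef
    have h : ∀ a, 0 < a → fsum (fun v => (a * v) ^ q * (Real.log (a * v) - (n + 1 : ℕ) * m) ^ 2)
        (tensorPow y n) = Q * a ^ q + M ^ n * (a ^ q * (Real.log a - m) ^ 2) := fun a ha => by
      have h1 : fsum (fun v => (a * v) ^ q * (Real.log (a * v) - (n + 1 : ℕ) * m) ^ 2)
          (tensorPow y n) = fsum (fun v => a ^ q * (v ^ q * (Real.log v - n * m) ^ 2) +
            ((2 * (a ^ q * (Real.log a - m))) * (v ^ q * (Real.log v - n * m)) +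
            (a ^ q * (Real.log a - m) ^ 2) * v ^ q)) (tensorPow y n) :=
        fsum_congr (tensorPow_nonneg hy n) fun v hv => by
          rw [Real.mul_rpow ha.le hv.le, Real.log_mul ha.ne' hv.ne']
          push_cast; ring
      rw [h1, fsum_add, fsum_add, fsum_const_mul, fsum_const_mul, fsum_const_mul,
        fsum_centered_tensorPow hy hm, fsum_rpow_tensorPow hy]
      ring
    rw [fsum_congr hy h, fsum_add, fsum_const_mul, fsum_const_mul]
    have h2 : Q * M ≤ n * V * M ^ n * M := mul_le_mul_of_nonneg_right ih hM
    have h3 : M ^ n * fsum (fun v => v ^ q * (Real.log v - m) ^ 2) y ≤ M ^ n * (V * M) :=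
      mul_le_mul_of_nonneg_left hV (pow_nonneg hM n)
    push_cast
    rw [pow_succ]
    linarith

/-- Lower bound of Cramér type for the excess of a tensor power over a threshold, obtained from
Chebyshev's inequality for the exponentially tilted weights. -/
theorem le_fsum_excess_tensorPow {ι : Type*} {y : ι →₀ ℝ} (hy : ∀ i, 0 ≤ y i) {l m V δ u : ℝ}
    {n : ℕ} (hl : 0 ≤ l) (hδ : 0 < δ) (hn : 1 ≤ n) (hu : 0 < u)
    (hm : fsum (fun v => v ^ (1 + l) * (Real.log v - m)) y = 0)
    (hV : fsum (fun v => v ^ (1 + l) * (Real.log v - m) ^ 2) y ≤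
      V * fsum (fun v => v ^ (1 + l)) y)
    (hn1 : Real.log 2 ≤ n * δ) (hn2 : 2 * V ≤ n * δ ^ 2) (hut : Real.log u ≤ n * (m - 2 * δ)) :
    1 / 4 * (fsum (fun v => v ^ (1 + l)) y * Real.exp (-(l * (m + δ)))) ^ n ≤
      fsum (fun v => max (v - u) 0) (tensorPow y n) := by
  have hn0 : (0 : ℝ) < n := by exact_mod_cast hn
  set M := fsum (fun v => v ^ (1 + l)) y with hM
  have hM0 : 0 ≤ M := Finset.sum_nonneg fun i _ => Real.rpow_nonneg (hy i) _
  set E := Real.exp (-(l * (n * (m + δ)))) with hE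
  have hEpow : Real.exp (-(l * (m + δ))) ^ n = E := by
    rw [← Real.exp_nat_mul]; congr 1; ring
  have hE0 : 0 < E := Real.exp_pos _
  -- A pointwise minorant containing Chebyshev's inequality. Within `n * δ` of the mean, `2 * u ≤ v`
  -- and `E * v ^ (1 + l) ≤ v`, so `v - u` is at least half of `E * v ^ (1 + l)`; farther away the
  -- minorant is nonpositive.
  have key : ∀ v, 0 < v → 1 / 2 * E * v ^ (1 + l) +
      (-(1 / 2 * E / (n * δ) ^ 2)) * (v ^ (1 + l) * (Real.log v - n * m) ^ 2) ≤
      max (v - u) 0 := by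
    intro v hv
    have hvq : 0 < v ^ (1 + l) := Real.rpow_pos_of_pos hv _
    have hnd : 0 < (n * δ) ^ 2 := by positivity
    rcases le_or_gt ((Real.log v - n * m) ^ 2) ((n * δ) ^ 2) with h | h
    · have habs := abs_le_of_sq_le_sq' h (by positivity)
      have h2u : 2 * u ≤ v := by
        rw [← Real.log_le_log_iff (by positivity) hv, Real.log_mul two_ne_zero hu.ne']
        nlinarith
      have hvl : E * v ^ (1 + l) ≤ v := by
        rw [Real.rpow_add hv, Real.rpow_one, Real.rpow_def_of_pos hv, mul_left_comm, hE,
          ← Real.exp_add]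
        refine mul_le_of_le_one_right hv.le (Real.exp_le_one_iff.2 ?_)
        have : Real.log v ≤ n * (m + δ) := by linarith
        nlinarith
      have h3 : 0 ≤ 1 / 2 * E / (n * δ) ^ 2 * (v ^ (1 + l) * (Real.log v - n * m) ^ 2) := by
        positivity
      refine le_trans ?_ (le_max_left _ _)
      linarith
    · refine le_trans ?_ (le_max_right _ _)
      have : 1 / 2 * E * v ^ (1 + l) +
          (-(1 / 2 * E / (n * δ) ^ 2)) * (v ^ (1 + l) * (Real.log v - n * m) ^ 2) =
          1 / 2 * E * v ^ (1 + l) * (1 - (Real.log v - n * m) ^ 2 / (n * δ) ^ 2) := by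
        ring
      rw [this]
      refine mul_nonpos_of_nonneg_of_nonpos (by positivity) ?_
      rw [sub_nonpos, one_le_div hnd]
      exact h.le
  refine le_trans ?_ (fsum_le_fsum (tensorPow_nonneg hy n) key)
  rw [fsum_add, fsum_const_mul, fsum_const_mul, fsum_rpow_tensorPow hy, mul_pow, hEpow]
  have hvar := fsum_variance_tensorPow_le hy hm hV n
  have h4 : 1 / 2 * E / (n * δ) ^ 2 *
      fsum (fun v => v ^ (1 + l) * (Real.log v - n * m) ^ 2) (tensorPow y n) ≤
      1 / 4 * (M ^ n * E) := by
    calc _ ≤ 1 / 2 * E / (n * δ) ^ 2 * (n * V * M ^ n) :=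
          mul_le_mul_of_nonneg_left hvar (by positivity)
      _ = 1 / 4 * (M ^ n * E) * (2 * V / (n * δ ^ 2)) := by field_simp; ring
      _ ≤ 1 / 4 * (M ^ n * E) * 1 := by
          refine mul_le_mul_of_nonneg_left ((div_le_one (by positivity)).2 hn2) (by positivity)
      _ = _ := mul_one _
  linarith

/-! ### The tilted mean -/

/-- The mean of `log` under the weights `y i ^ (1 + l)`, normalised. -/
noncomputable def tiltedMean {ι : Type*} (y : ι →₀ ℝ) (l : ℝ) : ℝ :=
  fsum (fun v => v ^ (1 + l) * Real.log v) y / fsum (fun v => v ^ (1 + l)) y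

theorem continuous_fsum_rpow {ι : Type*} (y : ι →₀ ℝ) :
    Continuous fun l : ℝ => fsum (fun v => v ^ (1 + l)) y := by
  refine continuous_finsetSum _ fun i hi => ?_
  exact (Real.continuous_const_rpow (Finsupp.mem_support_iff.1 hi)).comp (by fun_prop)

section

variable {ι : Type*} {y : ι →₀ ℝ}

theorem continuous_tiltedMean (hy : ∀ i, 0 ≤ y i) (sy : fsum (fun v => v) y = 1) :
    Continuous (tiltedMean y) := by
  refine Continuous.div ?_ (continuous_fsum_rpow y)
    fun l => (fsum_pos hy sy fun v hv => Real.rpow_pos_of_pos hv _).ne'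
  refine continuous_finsetSum _ fun i hi => Continuous.mul ?_ continuous_const
  exact (Real.continuous_const_rpow (Finsupp.mem_support_iff.1 hi)).comp (by fun_prop)

theorem fsum_sub_tiltedMean (hy : ∀ i, 0 ≤ y i) (sy : fsum (fun v => v) y = 1) (l : ℝ) :
    fsum (fun v => v ^ (1 + l) * (Real.log v - tiltedMean y l)) y = 0 := by
  have hM : 0 < fsum (fun v => v ^ (1 + l)) y := fsum_pos hy sy fun v hv =>
    Real.rpow_pos_of_pos hv _
  have : (fun v : ℝ => v ^ (1 + l) * (Real.log v - tiltedMean y l)) =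
      fun v => v ^ (1 + l) * Real.log v - tiltedMean y l * v ^ (1 + l) := by
    funext v; ring
  rw [this, fsum_sub, fsum_const_mul, tiltedMean, div_mul_cancel₀ _ hM.ne', sub_self]

theorem apply_le_one (hy : ∀ i, 0 ≤ y i) (sy : fsum (fun v => v) y = 1) (i : ι) : y i ≤ 1 := by
  by_cases h : y i = 0
  · rw [h]; exact zero_le_one
  · rw [← sy]
    exact le_fsum (F := fun v => v) (fun j _ => hy j) h

theorem le_tiltedMean (hy : ∀ i, 0 ≤ y i) (sy : fsum (fun v => v) y = 1) {c : ℝ} (hc : 0 < c)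
    (hcy : ∀ i ∈ y.support, c ≤ y i) (l : ℝ) : Real.log c ≤ tiltedMean y l := by
  have hM : 0 < fsum (fun v => v ^ (1 + l)) y := fsum_pos hy sy fun v hv =>
    Real.rpow_pos_of_pos hv _
  rw [tiltedMean, le_div_iff₀ hM, ← fsum_const_mul]
  refine fsum_le_fsum_of_mem fun i hi => ?_
  rw [mul_comm]
  exact mul_le_mul_of_nonneg_left (Real.log_le_log hc (hcy i hi)) (Real.rpow_nonneg (hy i) _)

theorem tiltedMean_nonpos (hy : ∀ i, 0 ≤ y i) (sy : fsum (fun v => v) y = 1) (l : ℝ) :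
    tiltedMean y l ≤ 0 := by
  have hM : 0 < fsum (fun v => v ^ (1 + l)) y := fsum_pos hy sy fun v hv =>
    Real.rpow_pos_of_pos hv _
  refine div_nonpos_of_nonpos_of_nonneg (Finset.sum_nonpos fun i _ => ?_) hM.le
  exact mul_nonpos_of_nonneg_of_nonpos (Real.rpow_nonneg (hy i) _)
    (Real.log_nonpos (hy i) (apply_le_one hy sy i))

/-- The difference of the two sides is the relative entropy of the tilted distribution with respect
to `y`, hence nonnegative. -/
theorem log_fsum_le_mul_tiltedMean (hy : ∀ i, 0 ≤ y i) (sy : fsum (fun v => v) y = 1) (l : ℝ) :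
    Real.log (fsum (fun v => v ^ (1 + l)) y) ≤ l * tiltedMean y l := by
  have hM : 0 < fsum (fun v => v ^ (1 + l)) y := fsum_pos hy sy fun v hv =>
    Real.rpow_pos_of_pos hv _
  set M := fsum (fun v => v ^ (1 + l)) y with hMdef
  rw [tiltedMean, mul_div_assoc', le_div_iff₀ hM]
  have h : fsum (fun v => v ^ (1 + l) - M * v) y ≤
      fsum (fun v => l * (v ^ (1 + l) * Real.log v) - Real.log M * v ^ (1 + l)) y := by
    refine fsum_le_fsum hy fun v hv => ?_
    have hvl : 0 < v ^ l := Real.rpow_pos_of_pos hv _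
    have h1 := Real.one_sub_inv_le_log_of_pos (div_pos hvl hM)
    rw [Real.log_div hvl.ne' hM.ne', Real.log_rpow hv, inv_div] at h1
    have h2 := mul_le_mul_of_nonneg_left h1 (Real.rpow_pos_of_pos hv (1 + l)).le
    have h3 : v ^ (1 + l) * (1 - M / v ^ l) = v ^ (1 + l) - M * v := by
      rw [Real.rpow_add hv, Real.rpow_one]; field_simp
    linarith
  rw [fsum_sub, fsum_sub, fsum_const_mul, fsum_const_mul, fsum_const_mul, sy, ← hMdef] at h
  linarith

/-- Both `log v` and its mean lie in `[log c, 0]`; the bound is uniform in `l`. -/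
theorem fsum_variance_tilted_le (hy : ∀ i, 0 ≤ y i) (sy : fsum (fun v => v) y = 1) {c : ℝ}
    (hc : 0 < c) (hcy : ∀ i ∈ y.support, c ≤ y i) (l : ℝ) :
    fsum (fun v => v ^ (1 + l) * (Real.log v - tiltedMean y l) ^ 2) y ≤
      Real.log c ^ 2 * fsum (fun v => v ^ (1 + l)) y := by
  rw [← fsum_const_mul]
  refine fsum_le_fsum_of_mem fun i hi => ?_
  rw [mul_comm]
  refine mul_le_mul_of_nonneg_right ?_ (Real.rpow_nonneg (hy i) _)
  have h1 := Real.log_le_log hc (hcy i hi)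
  have h2 := Real.log_nonpos (hy i) (apply_le_one hy sy i)
  have h3 := le_tiltedMean hy sy hc hcy l
  have h4 := tiltedMean_nonpos hy sy l
  rw [sq_le_sq, abs_of_nonpos (h1.trans h2), abs_le]
  constructor <;> linarith

end

/-! ### From strict inequalities to majorization of a tensor power -/

theorem tensorPow_le_pow {ι : Type*} {x : ι →₀ ℝ} (hx : ∀ i, 0 ≤ x i) {B : ℝ}
    (hB : ∀ i, x i ≤ B) (n : ℕ) (p : Fin n → ι) : tensorPow x n p ≤ B ^ n := by
  change ∏ k, x (p k) ≤ B ^ n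
  refine (Finset.prod_le_prod (fun k _ => hx (p k)) fun k _ => hB (p k)).trans ?_
  simp

theorem pow_le_tensorPow {ι : Type*} {y : ι →₀ ℝ} {c : ℝ} (hc : 0 ≤ c)
    (hcy : ∀ i ∈ y.support, c ≤ y i) (n : ℕ) (p : Fin n → ι) (hp : p ∈ (tensorPow y n).support) :
    c ^ n ≤ tensorPow y n p := by
  change c ^ n ≤ ∏ k, y (p k)
  have h : ∀ k, y (p k) ≠ 0 := fun k => by
    have h0 : ∏ k, y (p k) ≠ 0 := Finsupp.mem_support_iff.1 hp
    exact Finset.prod_ne_zero_iff.1 h0 k (Finset.mem_univ k)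
  have := Finset.prod_le_prod (s := Finset.univ) (f := fun _ : Fin n => c)
    (g := fun k => y (p k)) (fun _ _ => hc)
    fun k _ => hcy _ (Finsupp.mem_support_iff.2 (h k))
  simpa using this

/-- Below the least nonzero value of `y`, comparison of excesses follows by convexity from the
comparison at that value. -/
theorem majorizes_of_excess_le {ι : Type*} {x y : ι →₀ ℝ} (hx : ∀ i, 0 ≤ x i) (hy : ∀ i, 0 ≤ y i)
    (hxy : fsum (fun v => v) x = fsum (fun v => v) y) {c : ℝ} (hc : 0 < c)
    (hcy : ∀ i ∈ y.support, c ≤ y i)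
    (h : ∀ t, c ≤ t → fsum (fun v => max (v - t) 0) x ≤ fsum (fun v => max (v - t) 0) y) :
    Majorizes y x := by
  rw [majorizes_iff hx hy]
  refine ⟨hxy, fun t ht => ?_⟩
  rcases le_total c t with hct | htc
  · exact h t hct
  set θ := t / c with hθ
  have hθ0 : 0 ≤ θ := by positivity
  have hθ1 : θ ≤ 1 := (div_le_one hc).2 htc
  have htθ : t = θ * c := (div_mul_cancel₀ t hc.ne').symm
  have h1 : fsum (fun v => max (v - t) 0) x ≤
      (1 - θ) * fsum (fun v => v) x + θ * fsum (fun v => max (v - c) 0) x := by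
    rw [← fsum_const_mul, ← fsum_const_mul, ← fsum_add]
    refine fsum_le_fsum hx fun v hv => max_le ?_ ?_
    · have := mul_le_mul_of_nonneg_left (le_max_left (v - c) 0) hθ0
      rw [htθ]; linarith
    · have := mul_nonneg hθ0 (le_max_right (v - c) 0)
      have := mul_nonneg (sub_nonneg.2 hθ1) hv.le
      linarith
  have h2 : (1 - θ) * fsum (fun v => v) y + θ * fsum (fun v => max (v - c) 0) y ≤
      fsum (fun v => max (v - t) 0) y := by
    rw [← fsum_const_mul, ← fsum_const_mul, ← fsum_add]
    refine fsum_le_fsum_of_mem fun i hi => ?_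
    rw [max_eq_left (sub_nonneg.2 (hcy i hi))]
    refine le_trans (le_of_eq ?_) (le_max_left _ _)
    rw [htθ]; ring
  have h3 := mul_le_mul_of_nonneg_left (h c le_rfl) hθ0
  rw [hxy] at h1
  linarith

theorem exists_forall_le_of_lt {f g : ℝ → ℝ} (hf : Continuous f) (hg : Continuous g) {a b : ℝ}
    (hg0 : ∀ l ∈ Set.Icc a b, 0 < g l) (hlt : ∀ l ∈ Set.Icc a b, f l < g l) :
    ∃ η : ℝ, 0 < η ∧ ∀ l ∈ Set.Icc a b, f l ≤ Real.exp (-η) * g l := by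
  have hev : ∃ r : ℝ, 0 < r ∧ r < 1 ∧ ∀ l ∈ Set.Icc a b, f l ≤ r * g l := by
    rcases (Set.Icc a b).eq_empty_or_nonempty with he | hne
    · exact ⟨1 / 2, by norm_num, by norm_num, fun l hl => by simp [he] at hl⟩
    · obtain ⟨l₀, hl₀, hmax⟩ := isCompact_Icc.exists_isMaxOn hne
        (hf.continuousOn.div hg.continuousOn fun l hl => (hg0 l hl).ne')
      -- The floor `1 / 2` keeps the ratio positive, so that its logarithm is meaningful.
      refine ⟨max (f l₀ / g l₀) (1 / 2), by positivity, max_lt ?_ (by norm_num), fun l hl => ?_⟩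
      · exact (div_lt_one (hg0 _ hl₀)).2 (hlt _ hl₀)
      · rw [← div_le_iff₀ (hg0 l hl)]
        exact (hmax hl).trans (le_max_left _ _)
  obtain ⟨r, hr0, hr1, h⟩ := hev
  refine ⟨-Real.log r, neg_pos.2 (Real.log_neg hr0 hr1), ?_⟩
  rwa [neg_neg, Real.exp_log hr0]

/-- If the power sums of `x` are strictly dominated by those of `y`, if the largest value of `x` is
strictly below the largest value of `y`, and if some tilted power sum of `x` is small compared with
the least nonzero value of `y`, then some tensor power of `x` is majorized by that of `y`. -/
theorem exists_majorizes_tensorPow {ι : Type*} {x y : ι →₀ ℝ} (hx : ∀ i, 0 ≤ x i)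
    (hy : ∀ i, 0 ≤ y i) (sx : fsum (fun v => v) x = 1) (sy : fsum (fun v => v) y = 1)
    {c s₀ B : ℝ} (hc : 0 < c) (hcy : ∀ i ∈ y.support, c ≤ y i) (hs₀ : 0 ≤ s₀)
    (hxc : fsum (fun v => v ^ (1 + s₀)) x < c ^ s₀)
    (hlt : ∀ l : ℝ, 0 < l → fsum (fun v => v ^ (1 + l)) x < fsum (fun v => v ^ (1 + l)) y)
    (hB0 : 0 < B) (hB : ∀ i, x i ≤ B) {i₀ : ι} (hi₀ : B < y i₀) :
    ∃ n : ℕ, 1 ≤ n ∧ Majorizes (tensorPow y n) (tensorPow x n) := by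
  have hMx : ∀ l : ℝ, 0 < fsum (fun v => v ^ (1 + l)) x := fun l => fsum_pos hx sx fun v hv =>
    Real.rpow_pos_of_pos hv (1 + l)
  have hMy : ∀ l : ℝ, 0 < fsum (fun v => v ^ (1 + l)) y := fun l => fsum_pos hy sy fun v hv =>
    Real.rpow_pos_of_pos hv (1 + l)
  set b := Real.log B with hb
  set β := Real.log (y i₀) with hβ
  have hy₀ : 0 < y i₀ := hB0.trans hi₀
  have hbβ : b < β := Real.log_lt_log hB0 hi₀
  have hβ0 : β ≤ 0 := Real.log_nonpos hy₀.le (apply_le_one hy sy i₀)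
  have hcy₀ : c ≤ y i₀ := hcy _ (Finsupp.mem_support_iff.2 hy₀.ne')
  have hlc0 : Real.log c ≤ 0 := Real.log_nonpos hc.le (hcy₀.trans (apply_le_one hy sy i₀))
  set g := (β - b) / 4 with hg
  have hg0 : 0 < g := by rw [hg]; linarith
  -- the range of tilting parameters
  obtain ⟨Λ, hΛ0, hΛ⟩ : ∃ Λ : ℝ, 0 < Λ ∧ b + 3 * g ≤ tiltedMean y Λ := by
    -- The largest value alone gives `(1 + Λ) * β ≤ log M(Λ) ≤ Λ * tiltedMean y Λ`, with `M` the
    -- power sum. So the mean is at least `β + β / Λ ≥ β - g = b + 3 * g`.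
    refine ⟨1 + -β / g, ?_, ?_⟩
    · have : 0 ≤ -β / g := div_nonneg (neg_nonneg.2 hβ0) hg0.le
      linarith
    · set Λ := 1 + -β / g with hΛd
      have h0 : 0 ≤ -β / g := div_nonneg (neg_nonneg.2 hβ0) hg0.le
      have hΛ0 : 0 < Λ := by linarith
      have h1 := log_fsum_le_mul_tiltedMean hy sy Λ
      have h2 : (1 + Λ) * β ≤ Real.log (fsum (fun v => v ^ (1 + Λ)) y) := by
        rw [hβ, ← Real.log_rpow hy₀]
        exact Real.log_le_log (Real.rpow_pos_of_pos hy₀ _)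
          (le_fsum (F := fun v => v ^ (1 + Λ)) (fun i _ => Real.rpow_nonneg (hy i) _) hy₀.ne')
      have h3 : -β ≤ Λ * g := by
        have : Λ * g = g + -β := by rw [hΛd]; field_simp
        linarith
      have h4 : Λ * (b + 3 * g) ≤ Λ * tiltedMean y Λ := by
        have : b = β - 4 * g := by rw [hg]; ring
        rw [this]
        nlinarith
      exact le_of_mul_le_mul_left h4 hΛ0
  -- small tilting parameters
  set ρ := fsum (fun v => v ^ (1 + s₀)) x / c ^ s₀ with hρ
  have hcs : 0 < c ^ s₀ := Real.rpow_pos_of_pos hc _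
  have hρ0 : 0 < ρ := div_pos (hMx s₀) hcs
  have hρ1 : ρ < 1 := (div_lt_one hcs).2 hxc
  have hlρ : Real.log ρ < 0 := Real.log_neg hρ0 hρ1
  -- `C` bounds the decay rate of the lower bound for `y` per unit of `l`; `a` is chosen so that for
  -- `l < a` this rate is at most half of `-log ρ`.
  set C := 1 - Real.log c with hC
  have hC0 : 0 < C := by linarith
  set a := -Real.log ρ / 2 / C with ha
  have ha0 : 0 < a := div_pos (by linarith) hC0
  have haC : a * C = -Real.log ρ / 2 := div_mul_cancel₀ _ hC0.ne'
  -- large tilting parameters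
  obtain ⟨η, hη0, hη⟩ := exists_forall_le_of_lt (a := a) (b := Λ) (continuous_fsum_rpow x)
    (continuous_fsum_rpow y) (fun l _ => hMy l) fun l hl => hlt l (ha0.trans_le hl.1)
  -- `δ ≤ 1` serves the constant `C`, `δ ≤ g` keeps the thresholds in reach of `Λ`, and `3 * Λ * δ`
  -- is the total loss in comparing the two bounds, kept below half of the gap `η`.
  obtain ⟨δ, hδ0, hδ1, hδg, hδη⟩ : ∃ δ : ℝ, 0 < δ ∧ δ ≤ 1 ∧ δ ≤ g ∧ 3 * Λ * δ ≤ η / 2 := by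
    refine ⟨min 1 (min g (η / 2 / (3 * Λ))), by positivity, min_le_left _ _,
      (min_le_right _ _).trans (min_le_left _ _), ?_⟩
    have h1 : min 1 (min g (η / 2 / (3 * Λ))) ≤ η / 2 / (3 * Λ) :=
      (min_le_right _ _).trans (min_le_right _ _)
    rwa [le_div_iff₀ (by positivity), mul_comm] at h1
  -- the exponent
  have ev1 : ∀ r : ℝ, 0 < r → ∀ K : ℝ, ∀ᶠ n : ℕ in Filter.atTop, K ≤ n * r := fun r hr K => by
    filter_upwards [Filter.tendsto_atTop.1 (tendsto_natCast_atTop_atTop (R := ℝ)) (K / r)] with n hn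
    rwa [← div_le_iff₀ hr]
  have ev2 : ∀ z : ℝ, z < 0 → ∀ᶠ n : ℕ in Filter.atTop, 4 * Real.exp z ^ n ≤ 1 := fun z hz => by
    have h1 : ∀ᶠ n : ℕ in Filter.atTop, Real.exp z ^ n < 1 / 4 :=
      (tendsto_pow_atTop_nhds_zero_of_lt_one (Real.exp_pos z).le
        (Real.exp_lt_one_iff.2 hz)).eventually_lt_const (by norm_num)
    filter_upwards [h1] with n hn
    linarith
  obtain ⟨n, hn1, hnδ, hnV, hnρ, hnη⟩ := ((Filter.eventually_ge_atTop 1).and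
    ((ev1 δ hδ0 (Real.log 2)).and ((ev1 (δ ^ 2) (by positivity) (2 * Real.log c ^ 2)).and
    ((ev2 (Real.log ρ / 2) (by linarith)).and (ev2 (-(η / 2)) (by linarith)))))).exists
  have hn0 : (0 : ℝ) < n := by exact_mod_cast hn1
  refine ⟨n, hn1, majorizes_of_excess_le (tensorPow_nonneg hx n) (tensorPow_nonneg hy n) ?_
    (pow_pos hc n) (fun p hp => pow_le_tensorPow hc.le hcy n p hp) fun u hcu => ?_⟩
  · rw [fsum_tensorPow_eq_one hx sx, fsum_tensorPow_eq_one hy sy]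
  have hu0 : 0 < u := (pow_pos hc n).trans_le hcu
  have hlow : ∀ l : ℝ, 0 ≤ l → Real.log u ≤ n * (tiltedMean y l - 2 * δ) →
      1 / 4 * (fsum (fun v => v ^ (1 + l)) y * Real.exp (-(l * (tiltedMean y l + δ)))) ^ n ≤
      fsum (fun v => max (v - u) 0) (tensorPow y n) := fun l hl hut =>
    le_fsum_excess_tensorPow hy hl hδ0 hn1 hu0 (fsum_sub_tiltedMean hy sy l)
      (fsum_variance_tilted_le hy sy hc hcy l) hnδ hnV hut
  rcases le_or_gt u (B ^ n) with huB | hBu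
  swap
  · have h1 : fsum (fun v => max (v - u) 0) (tensorPow x n) = 0 := by
      refine Finset.sum_eq_zero fun p _ => max_eq_right ?_
      linarith [tensorPow_le_pow hx hB n p]
    rw [h1]
    exact Finset.sum_nonneg fun p _ => le_max_right _ _
  have hub : Real.log u / n ≤ b := by
    rw [div_le_iff₀ hn0, mul_comm, hb, ← Real.log_pow]
    exact Real.log_le_log hu0 huB
  -- For thresholds below the untilted typical size, `l = 0` works; otherwise the intermediate value
  -- theorem matches the tilted mean to the threshold.
  obtain ⟨l, hl0, hlΛ, hlu, hleq⟩ : ∃ l : ℝ, 0 ≤ l ∧ l ≤ Λ ∧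
      Real.log u ≤ n * (tiltedMean y l - 2 * δ) ∧
      (0 < l → Real.log u = n * (tiltedMean y l - 2 * δ)) := by
    rcases le_or_gt (Real.log u / n) (tiltedMean y 0 - 2 * δ) with h | h
    · rw [div_le_iff₀ hn0, mul_comm] at h
      exact ⟨0, le_rfl, hΛ0.le, h, fun h => absurd h (lt_irrefl _)⟩
    · obtain ⟨l, hl, hlt⟩ := intermediate_value_Icc hΛ0.le
        (continuous_tiltedMean hy sy).continuousOn
        (show Real.log u / n + 2 * δ ∈ Set.Icc (tiltedMean y 0) (tiltedMean y Λ) from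
          ⟨by linarith, by linarith⟩)
      have : Real.log u = n * (tiltedMean y l - 2 * δ) := by
        rw [hlt, add_sub_cancel_right, mul_div_cancel₀ _ hn0.ne']
      exact ⟨l, hl.1, hl.2, this.le, fun _ => this⟩
  refine le_trans ?_ (hlow l hl0 hlu)
  rcases lt_or_ge l a with hla | hal
  · -- compare through the parameter `s₀`
    have h1 : fsum (fun v => max (v - u) 0) (tensorPow x n) ≤ ρ ^ n := by
      refine (fsum_excess_tensorPow_le hx hs₀ hu0 n).trans ?_
      rw [hρ, div_pow, div_eq_mul_inv, Real.rpow_neg hu0.le]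
      refine mul_le_mul_of_nonneg_left (inv_anti₀ (pow_pos hcs n) ?_) (pow_pos (hMx s₀) n).le
      rw [← Real.rpow_natCast (c ^ s₀), ← Real.rpow_mul hc.le, mul_comm, Real.rpow_mul hc.le,
        Real.rpow_natCast]
      exact Real.rpow_le_rpow (pow_pos hc n).le hcu hs₀
    have h2 : Real.exp (l * Real.log c) ≤ fsum (fun v => v ^ (1 + l)) y := by
      have : Real.exp (l * Real.log c) * fsum (fun v => v) y ≤ fsum (fun v => v ^ (1 + l)) y := by
        rw [← fsum_const_mul]
        refine fsum_le_fsum_of_mem fun i hi => ?_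
        have hyi : 0 < y i := hc.trans_le (hcy i hi)
        rw [Real.rpow_add hyi, Real.rpow_one, mul_comm]
        refine mul_le_mul_of_nonneg_left ?_ hyi.le
        rw [mul_comm, ← Real.rpow_def_of_pos hc]
        exact Real.rpow_le_rpow hc.le (hcy i hi) hl0
      simpa [sy] using this
    have h3 : Real.exp (-(a * C)) ≤
        fsum (fun v => v ^ (1 + l)) y * Real.exp (-(l * (tiltedMean y l + δ))) := by
      refine le_trans ?_ (mul_le_mul_of_nonneg_right h2 (Real.exp_pos _).le)
      rw [← Real.exp_add, Real.exp_le_exp]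
      have hD : tiltedMean y l + δ - Real.log c ≤ C := by
        have := tiltedMean_nonpos hy sy l
        rw [hC]; linarith
      have h4 : l * (tiltedMean y l + δ - Real.log c) ≤ l * C := mul_le_mul_of_nonneg_left hD hl0
      have h5 : l * C ≤ a * C := mul_le_mul_of_nonneg_right hla.le hC0.le
      linarith
    -- Half of the exponent of `ρ` absorbs the factor `1 / 4`; the other half is the bound for `y`.
    have h6 : ρ = Real.exp (Real.log ρ / 2) * Real.exp (-(a * C)) := by
      rw [← Real.exp_add, haC, show Real.log ρ / 2 + -(-Real.log ρ / 2) = Real.log ρ by ring,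
        Real.exp_log hρ0]
    have h7 : Real.exp (-(a * C)) ^ n ≤
        (fsum (fun v => v ^ (1 + l)) y * Real.exp (-(l * (tiltedMean y l + δ)))) ^ n :=
      pow_le_pow_left₀ (Real.exp_pos _).le h3 n
    refine h1.trans ?_
    rw [h6, mul_pow]
    have h8 : 0 < Real.exp (-(a * C)) ^ n := by positivity
    have h9 := mul_le_mul_of_nonneg_right hnρ h8.le
    linarith
  · -- compare at the same parameter
    have hueq := hleq (ha0.trans_le hal)
    have h1 := fsum_excess_tensorPow_le hx hl0 hu0 n
    have h2 : u ^ (-l) = Real.exp (-(l * (tiltedMean y l - 2 * δ))) ^ n := by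
      rw [Real.rpow_def_of_pos hu0, hueq, ← Real.exp_nat_mul]
      congr 1; ring
    rw [h2, ← mul_pow] at h1
    refine h1.trans ?_
    have h3 : fsum (fun v => v ^ (1 + l)) x * Real.exp (-(l * (tiltedMean y l - 2 * δ))) ≤
        Real.exp (-(η / 2)) *
          (fsum (fun v => v ^ (1 + l)) y * Real.exp (-(l * (tiltedMean y l + δ)))) := by
      have h4 : Real.exp (-η) * Real.exp (-(l * (tiltedMean y l - 2 * δ))) ≤
          Real.exp (-(η / 2)) * Real.exp (-(l * (tiltedMean y l + δ))) := by
        rw [← Real.exp_add, ← Real.exp_add, Real.exp_le_exp]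
        have : l * δ ≤ Λ * δ := mul_le_mul_of_nonneg_right hlΛ hδ0.le
        linarith
      calc _ ≤ Real.exp (-η) * fsum (fun v => v ^ (1 + l)) y *
            Real.exp (-(l * (tiltedMean y l - 2 * δ))) :=
            mul_le_mul_of_nonneg_right (hη l ⟨hal, hlΛ⟩) (Real.exp_pos _).le
        _ = fsum (fun v => v ^ (1 + l)) y *
            (Real.exp (-η) * Real.exp (-(l * (tiltedMean y l - 2 * δ)))) := by ring
        _ ≤ fsum (fun v => v ^ (1 + l)) y *
            (Real.exp (-(η / 2)) * Real.exp (-(l * (tiltedMean y l + δ)))) :=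
            mul_le_mul_of_nonneg_left h4 (hMy l).le
        _ = _ := by ring
    refine (pow_le_pow_left₀ (mul_pos (hMx l) (Real.exp_pos _)).le h3 n).trans ?_
    rw [mul_pow]
    have h5 : 0 < (fsum (fun v => v ^ (1 + l)) y *
        Real.exp (-(l * (tiltedMean y l + δ)))) ^ n :=
      pow_pos (mul_pos (hMy l) (Real.exp_pos _)) n
    have h6 := mul_le_mul_of_nonneg_right hnη h5.le
    linarith

/-! ### Perturbation by a spread-out uniform part -/

/-- The mixture `(1 - ε) x + ε u`, where `u` is the uniform distribution on `{K, …, K + N - 1}`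
and `x` is supported in `{0, …, K - 1}`. -/
noncomputable def spread (x : ℕ →₀ ℝ) (K N : ℕ) (ε : ℝ) : ℕ →₀ ℝ :=
  Finsupp.onFinset (range (K + N))
    (fun i => if i < K then (1 - ε) * x i else if i < K + N then ε / N else 0) fun i hi => by
      by_contra h
      rw [Finset.mem_range] at h
      exact hi (by rw [if_neg (by omega), if_neg h])

theorem spread_apply (x : ℕ →₀ ℝ) (K N : ℕ) (ε : ℝ) (i : ℕ) :
    spread x K N ε i = if i < K then (1 - ε) * x i else if i < K + N then ε / N else 0 := rfl

theorem spread_of_lt (x : ℕ →₀ ℝ) {K : ℕ} (N : ℕ) (ε : ℝ) {i : ℕ} (hi : i < K) :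
    spread x K N ε i = (1 - ε) * x i := by rw [spread_apply, if_pos hi]

theorem spread_add (x : ℕ →₀ ℝ) (K : ℕ) {N : ℕ} (ε : ℝ) {j : ℕ} (hj : j < N) :
    spread x K N ε (K + j) = ε / N := by
  rw [spread_apply, if_neg (by omega), if_pos (by omega)]

theorem fsum_spread {F : ℝ → ℝ} (hF : F 0 = 0) {x : ℕ →₀ ℝ} {K : ℕ}
    (hK : x.support ⊆ range K) (N : ℕ) (ε : ℝ) :
    fsum F (spread x K N ε) = fsum (fun v => F ((1 - ε) * v)) x + N * F (ε / N) := by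
  have h1 : fsum F (spread x K N ε) = ∑ i ∈ range (K + N), F (spread x K N ε i) :=
    Finset.sum_subset Finsupp.support_onFinset_subset fun i _ hi => by
      rw [Finsupp.notMem_support_iff.1 hi, hF]
  have h2 : fsum (fun v => F ((1 - ε) * v)) x = ∑ i ∈ range K, F ((1 - ε) * x i) :=
    Finset.sum_subset hK fun i _ hi => by
      simp only [Finsupp.notMem_support_iff.1 hi, mul_zero, hF]
  rw [h1, h2, Finset.sum_range_add]
  congr 1
  · exact Finset.sum_congr rfl fun i hi => by rw [spread_of_lt x N ε (Finset.mem_range.1 hi)]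
  · rw [Finset.sum_congr rfl fun j hj => by rw [spread_add x K ε (Finset.mem_range.1 hj)]]
    simp

theorem spread_nonneg {x : ℕ →₀ ℝ} (hx : ∀ i, 0 ≤ x i) (K N : ℕ) {ε : ℝ} (h0 : 0 ≤ ε)
    (h1 : ε ≤ 1) (i : ℕ) : 0 ≤ spread x K N ε i := by
  rw [spread_apply]
  split_ifs
  · exact mul_nonneg (sub_nonneg.2 h1) (hx i)
  · positivity
  · exact le_rfl

theorem spread_mem_probVec {x : ℕ →₀ ℝ} (hx : x ∈ probVec) {K N : ℕ}
    (hK : x.support ⊆ range K) (hN : 1 ≤ N) {ε : ℝ} (h0 : 0 ≤ ε) (h1 : ε ≤ 1) :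
    spread x K N ε ∈ probVec := by
  refine ⟨spread_nonneg hx.1 K N h0 h1, ?_⟩
  have hN0 : (N : ℝ) ≠ 0 := by positivity
  rw [sum_eq_fsum, fsum_spread rfl hK, fsum_const_mul, ← sum_eq_fsum, hx.2,
    mul_div_cancel₀ _ hN0]
  ring

theorem norm_toL1_spread_sub {x : ℕ →₀ ℝ} (hx : x ∈ probVec) {K N : ℕ}
    (hK : x.support ⊆ range K) (hN : 1 ≤ N) {ε : ℝ} (h0 : 0 ≤ ε) :
    ‖toL1 (spread x K N ε) - toL1 x‖ = 2 * ε := by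
  have hN0 : (N : ℝ) ≠ 0 := by positivity
  have hxK : ∀ i, K ≤ i → x i = 0 := fun i hi => by
    by_contra h
    have := Finset.mem_range.1 (hK (Finsupp.mem_support_iff.2 h))
    omega
  rw [lp.norm_eq_tsum_rpow (by simp)]
  simp only [ENNReal.toReal_one, Real.rpow_one, div_one, lp.coeFn_sub, Pi.sub_apply, toL1_apply]
  rw [tsum_eq_sum (s := range (K + N)), Finset.sum_range_add]
  · have h1 : ∑ i ∈ range K, ‖spread x K N ε i - x i‖ = ε * ∑ i ∈ range K, x i := by
      rw [Finset.mul_sum]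
      refine Finset.sum_congr rfl fun i hi => ?_
      rw [spread_of_lt x N ε (Finset.mem_range.1 hi), show (1 - ε) * x i - x i = -(ε * x i) by ring,
        norm_neg, Real.norm_of_nonneg (mul_nonneg h0 (hx.1 i))]
    have h2 : ∑ j ∈ range N, ‖spread x K N ε (K + j) - x (K + j)‖ = ∑ j ∈ range N, ε / N := by
      refine Finset.sum_congr rfl fun j hj => ?_
      rw [spread_add x K ε (Finset.mem_range.1 hj), hxK _ (by omega), sub_zero,
        Real.norm_of_nonneg (by positivity)]
    have h3 : ∑ i ∈ range K, x i = 1 := by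
      rw [← hx.2]
      exact (Finset.sum_subset hK fun i _ hi => Finsupp.notMem_support_iff.1 hi).symm
    rw [h1, h2, h3, Finset.sum_const, Finset.card_range, nsmul_eq_mul, mul_div_cancel₀ _ hN0]
    ring
  · intro i hi
    rw [Finset.mem_range] at hi
    rw [spread_apply, if_neg (by omega), if_neg hi, hxK i (by omega), sub_zero, norm_zero]

/-- The limit `p → ∞` of the norm inequalities, made finite: a larger `x i` would violate `x i ^ (1
+ n) ≤ β ^ n` for some large `n`. -/
theorem le_of_forall_fsum_rpow_le {ι κ : Type*} {x : ι →₀ ℝ} {y : κ →₀ ℝ} (hx : ∀ i, 0 ≤ x i)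
    (hy : ∀ i, 0 ≤ y i) (sy : fsum (fun v => v) y = 1) {β : ℝ} (hβ0 : 0 < β)
    (hβ : ∀ i, y i ≤ β)
    (h : ∀ p : ℝ, 1 ≤ p → fsum (fun v => v ^ p) x ≤ fsum (fun v => v ^ p) y) (i : ι) :
    x i ≤ β := by
  by_contra! hlt
  have hα : 0 < x i := hβ0.trans hlt
  obtain ⟨n, hn⟩ := pow_unbounded_of_one_lt (1 / x i) ((one_lt_div hβ0).2 hlt)
  have h1 : x i ^ (1 + n : ℝ) ≤ fsum (fun v => v ^ (1 + n : ℝ)) x :=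
    le_fsum (F := fun v => v ^ (1 + n : ℝ)) (fun j _ => Real.rpow_nonneg (hx j) _) hα.ne'
  have h2 : fsum (fun v => v ^ (1 + n : ℝ)) y ≤ β ^ n := by
    refine le_trans ?_ (by rw [fsum_const_mul, sy, mul_one] :
      fsum (fun v => β ^ n * v) y ≤ β ^ n)
    refine fsum_le_fsum_of_mem fun j hj => ?_
    have hyj : 0 < y j := lt_of_le_of_ne (hy j) (Ne.symm (Finsupp.mem_support_iff.mp hj))
    rw [Real.rpow_add hyj, Real.rpow_one, Real.rpow_natCast, mul_comm]
    exact mul_le_mul_of_nonneg_right (pow_le_pow_left₀ hyj.le (hβ j) n) hyj.le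
  have h3 := h1.trans ((h _ (by linarith [n.cast_nonneg (α := ℝ)])).trans h2)
  rw [Real.rpow_add hα, Real.rpow_one, Real.rpow_natCast] at h3
  rw [div_pow, div_lt_div_iff₀ hα (by positivity)] at hn
  linarith

theorem exists_spread_mem_multiCopySet {x y : ℕ →₀ ℝ} (hx : x ∈ probVec) (hy : y ∈ probVec)
    (h : ∀ p : ℝ, 1 ≤ p → fsum (fun v => v ^ p) x ≤ fsum (fun v => v ^ p) y) {K : ℕ}
    (hK : x.support ⊆ range K) {ε : ℝ} (hε0 : 0 < ε) (hε1 : ε < 1) :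
    ∃ N : ℕ, 1 ≤ N ∧ spread x K N ε ∈ multiCopySet y := by
  have sx : fsum (fun v => v) x = 1 := hx.2
  have sy : fsum (fun v => v) y = 1 := hy.2
  obtain ⟨j₀, hj₀, hmin⟩ := y.support.exists_min_image y (support_nonempty sy)
  obtain ⟨i₀, hi₀, hmax⟩ := y.support.exists_max_image y (support_nonempty sy)
  set c := y j₀ with hcdef
  have hc : 0 < c := lt_of_le_of_ne (hy.1 j₀) (Ne.symm (Finsupp.mem_support_iff.mp hj₀))
  have hci : c ≤ y i₀ := hmin i₀ hi₀
  have hy₀ : 0 < y i₀ := hc.trans_le hci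
  have hβ : ∀ i, y i ≤ y i₀ := fun i => by
    by_cases hi : i ∈ y.support
    · exact hmax i hi
    · rw [Finsupp.notMem_support_iff.1 hi]; exact hy₀.le
  -- `c` depends on `y` only, so `s₀` is fixed before `N`. Then `(1 / N) ^ s₀ < 1 / 2` bounds the
  -- power sum of the perturbed vector by `1 - ε / 2 < c ^ s₀`.
  obtain ⟨s₀, hs₀, hcs⟩ : ∃ s : ℝ, 0 < s ∧ 1 - ε / 2 < c ^ s := by
    have h1 : Filter.Tendsto (fun s : ℝ => c ^ s) (nhdsWithin 0 (Set.Ioi 0)) (nhds 1) := by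
      have := (Real.continuous_const_rpow hc.ne').tendsto 0
      rw [Real.rpow_zero] at this
      exact this.mono_left nhdsWithin_le_nhds
    obtain ⟨s, hs, hs'⟩ := ((h1.eventually_const_lt (by linarith : 1 - ε / 2 < 1)).and
      self_mem_nhdsWithin).exists
    exact ⟨s, hs', hs⟩
  -- `1 / N < c` puts the power sums of the uniform part strictly below those of `y`, which yields
  -- strictness for every `l > 0`.
  obtain ⟨N, hN1, hNc, hNs⟩ : ∃ N : ℕ, 1 ≤ N ∧ 1 / (N : ℝ) < c ∧ (1 / (N : ℝ)) ^ s₀ < 1 / 2 := by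
    have h1 : Filter.Tendsto (fun n : ℕ => 1 / (n : ℝ)) Filter.atTop (nhds 0) :=
      tendsto_one_div_atTop_nhds_zero_nat
    have h2 : Filter.Tendsto (fun n : ℕ => (1 / (n : ℝ)) ^ s₀) Filter.atTop (nhds 0) := by
      have := h1.rpow_const (p := s₀) (Or.inr hs₀.le)
      rwa [Real.zero_rpow hs₀.ne'] at this
    exact ((Filter.eventually_ge_atTop 1).and ((h1.eventually_lt_const hc).and
      (h2.eventually_lt_const (by norm_num)))).exists
  have hN0 : (0 : ℝ) < N := by exact_mod_cast hN1
  have hpv := spread_mem_probVec hx hK hN1 hε0.le hε1.le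
  have hsum : ∀ l : ℝ, 0 ≤ l → fsum (fun v => v ^ (1 + l)) (spread x K N ε) ≤
      (1 - ε) * fsum (fun v => v ^ (1 + l)) x + ε * (1 / (N : ℝ)) ^ l := fun l hl => by
    rw [fsum_spread (F := fun v => v ^ (1 + l)) (Real.zero_rpow (by linarith)) hK, ← fsum_const_mul]
    have key : ∀ r : ℝ, 0 < r → r ≤ 1 → r ^ (1 + l) ≤ r := fun r hr0 hr1 => by
      rw [Real.rpow_add hr0, Real.rpow_one]
      exact mul_le_of_le_one_right hr0.le (Real.rpow_le_one hr0.le hr1 hl)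
    refine add_le_add (fsum_le_fsum hx.1 fun v hv => ?_) ?_
    · rw [Real.mul_rpow (by linarith) hv.le]
      exact mul_le_mul_of_nonneg_right (key _ (by linarith) (by linarith))
        (Real.rpow_nonneg hv.le _)
    · have h1 : (N : ℝ) * (ε / N) ^ (1 + l) = ε ^ (1 + l) * (1 / (N : ℝ)) ^ l := by
        rw [div_eq_mul_one_div, Real.mul_rpow hε0.le (by positivity),
          Real.rpow_add (by positivity : (0 : ℝ) < 1 / N), Real.rpow_one]
        field_simp
      rw [h1]
      exact mul_le_mul_of_nonneg_right (key ε hε0 hε1.le) (by positivity)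
  have hNε : ε / N < ε * y i₀ := by
    rw [div_eq_mul_one_div]
    exact mul_lt_mul_of_pos_left (hNc.trans_le hci) hε0
  refine ⟨N, hN1, hpv, exists_majorizes_tensorPow (c := c) (s₀ := s₀)
    (B := max ((1 - ε) * y i₀) (ε / N)) (i₀ := i₀) hpv.1 hy.1 hpv.2 sy hc hmin hs₀.le ?_ ?_ ?_
    ?_ ?_⟩
  · refine (hsum s₀ hs₀.le).trans_lt ?_
    have h1 : fsum (fun v => v ^ (1 + s₀)) x ≤ 1 := by
      refine le_trans ?_ sx.le
      refine fsum_le_fsum_of_mem fun i hi => ?_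
      have hxi : 0 < x i := lt_of_le_of_ne (hx.1 i) (Ne.symm (Finsupp.mem_support_iff.mp hi))
      rw [Real.rpow_add hxi, Real.rpow_one]
      exact mul_le_of_le_one_right hxi.le
        (Real.rpow_le_one hxi.le (apply_le_one hx.1 sx i) hs₀.le)
    have h2 := mul_le_mul_of_nonneg_left h1 (by linarith : 0 ≤ 1 - ε)
    have h3 := mul_lt_mul_of_pos_left hNs hε0
    linarith
  · intro l hl
    refine (hsum l hl.le).trans_lt ?_
    have h1 := mul_le_mul_of_nonneg_left (h (1 + l) (by linarith)) (by linarith : 0 ≤ 1 - ε)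
    have h2 : (1 / (N : ℝ)) ^ l < c ^ l := Real.rpow_lt_rpow (by positivity) hNc hl
    have h3 : c ^ l ≤ fsum (fun v => v ^ (1 + l)) y := by
      refine le_trans (by rw [fsum_const_mul, sy, mul_one] :
        c ^ l ≤ fsum (fun v => c ^ l * v) y) ?_
      refine fsum_le_fsum_of_mem fun i hi => ?_
      have hyi : 0 < y i := hc.trans_le (hmin i hi)
      rw [Real.rpow_add hyi, Real.rpow_one, mul_comm]
      exact mul_le_mul_of_nonneg_left (Real.rpow_le_rpow hc.le (hmin i hi) hl.le) hyi.le
    have h4 := mul_lt_mul_of_pos_left (h2.trans_le h3) hε0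
    linarith
  · exact lt_max_of_lt_right (by positivity)
  · intro i
    rw [spread_apply]
    split_ifs
    · exact le_max_of_le_left (mul_le_mul_of_nonneg_left
        (le_of_forall_fsum_rpow_le hx.1 hy.1 sy hy₀ hβ h i) (by linarith))
    · exact le_max_right _ _
    · exact le_max_of_le_right (by positivity)
  · refine max_lt ?_ ?_
    · have := mul_pos hε0 hy₀
      linarith
    · refine hNε.trans_le ?_
      exact mul_le_of_le_one_left hy₀.le hε1.le

theorem mem_closure_multiCopySet {x y : ℕ →₀ ℝ} (hx : x ∈ probVec) (hy : y ∈ probVec)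
    (h : ∀ p : ℝ, 1 ≤ p → fsum (fun v => v ^ p) x ≤ fsum (fun v => v ^ p) y) :
    toL1 x ∈ closure (toL1 '' multiCopySet y) := by
  rw [Metric.mem_closure_iff]
  intro r hr
  obtain ⟨K, hK⟩ := x.support.exists_nat_subset_range
  set ε := min (1 / 2) (r / 3) with hε
  have hε0 : 0 < ε := by positivity
  have hεr : ε ≤ r / 3 := min_le_right _ _
  obtain ⟨N, hN, hmem⟩ := exists_spread_mem_multiCopySet hx hy h hK hε0
    ((min_le_left _ _).trans_lt (by norm_num))
  refine ⟨_, ⟨_, hmem, rfl⟩, ?_⟩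
  rw [dist_comm, dist_eq_norm, norm_toL1_spread_sub hx hK hN hε0.le]
  linarith

end CatMaj

theorem theorem1 (x y : ℕ →₀ ℝ) (hx : x ∈ CatMaj.probVec) (hy : y ∈ CatMaj.probVec) :
    List.TFAE [
      CatMaj.toL1 x ∈ closure (CatMaj.toL1 '' CatMaj.multiCopySet y),
      CatMaj.toL1 x ∈ closure (CatMaj.toL1 '' CatMaj.trumpedSet y),
      ∀ p : ℝ, 1 ≤ p → CatMaj.pNorm p x ≤ CatMaj.pNorm p y] := by
  tfae_have 1 → 2 := fun h =>
    closure_mono (Set.image_mono (CatMaj.multiCopySet_subset_trumpedSet hy)) h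
  tfae_have 2 → 3 := fun h p hp =>
    (CatMaj.pNorm_le_pNorm_iff hx.1 hy.1 hp).2 (CatMaj.fsum_rpow_le_of_mem_closure hx hy h hp)
  tfae_have 3 → 1 := fun h =>
    CatMaj.mem_closure_multiCopySet hx hy fun p hp =>
      (CatMaj.pNorm_le_pNorm_iff hx.1 hy.1 hp).1 (h p hp)
  tfae_finish
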